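/- Theorem 2.1 (Shallow terminals). All graphs are finite, simple and undirected. A graph is an interval graph if its vertices can be assigned to intervals of the real line so that two distinct vertices are adjacent if and only if their intervals intersect. A set $X$ of vertices of a graph $G$ is a minimal forbidden set if $G[X]$ is not an interval graph but $G[Y]$ is one for every proper subset $Y \subset X$. A module of $G$ is a set $M \subseteq V(G)$ all of whose vertices have the same neighbors outside $M$; it is nontrivial if $1 < |M| < |V(G)|$. The graph $G$ is reduced if it has no minimal forbidden set of at most $10$ vertices and every nontrivial module of $G$ induces a clique. For $d \ge 3$, a $\dag$-asteroidal witness is a graph with the $d+4$ vertices $s, c, b_0, b_1, \dots, b_{d+1}$ whose edges are $sc$, $cb_i$ for $1 \le i \le d$, and $b_ib_{i+1}$ for $0 \le i \le d$. For $d \ge 2$, a $\ddag$-asteroidal witness is a graph with the $d+5$ vertices $s, c_1, c_2, b_0, b_1, \dots, b_{d+1}$ whose edges are $sc_1$, $sc_2$, $c_1c_2$, $c_1b_i$ for $0 \le i \le d$, $c_2b_i$ for $1 \le i \le d+1$, and $b_ib_{i+1}$ for $0 \le i \le d$. An asteroidal triple of a graph consists of three distinct vertices each pair of which is connected by a path that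 contains no neighbor of the third. Let $W$ be a set of vertices of $G$ such that $G[W]$ is (isomorphic to) a $\dag$- or $\ddag$-asteroidal witness. A terminal of $W$ is a member of an asteroidal triple of $G[W]$, and a shallow terminal of $W$ is a terminal $x$ of $W$ such that $W \setminus N[x]$ induces a path. Then, in every reduced graph $G$, every shallow terminal $s$ of every $\dag$- or $\ddag$-asteroidal witness $W$ in $G$ is simplicial, that is, its neighborhood $N(s)$ induces a clique. -/

import Mathlib

namespace IntervalDeletion

variable {V : Type*}

/-- `G` is an interval graph: its vertices can be assigned to nonempty closed intervals
`[a v, b v]` of the real line such that two distinct vertices are adjacent if and only if their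
intervals intersect. -/
def IsIntervalGraph (G : SimpleGraph V) : Prop :=
  ∃ a b : V → ℝ, (∀ v, a v ≤ b v) ∧
    ∀ u v, u ≠ v → (G.Adj u v ↔ (Set.Icc (a u) (b u) ∩ Set.Icc (a v) (b v)).Nonempty)

/-- `X` is a minimal forbidden set: `X` does not induce an interval graph, but every proper
subset of `X` does. -/
def IsMinimalForbiddenSet (G : SimpleGraph V) (X : Set V) : Prop :=
  ¬ IsIntervalGraph (G.induce X) ∧ ∀ Y : Set V, Y ⊂ X → IsIntervalGraph (G.induce Y)

/-- `G` is prereduced: it has no minimal forbidden set of at most 10 vertices. -/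
def IsPrereduced (G : SimpleGraph V) : Prop :=
  ∀ X : Set V, IsMinimalForbiddenSet G X → ¬ X.encard ≤ 10

/-- `M` is a module: all vertices of `M` have the same neighbors outside `M`. -/
def IsModule (G : SimpleGraph V) (M : Set V) : Prop :=
  ∀ u ∈ M, ∀ v ∈ M, ∀ x, x ∉ M → (G.Adj u x ↔ G.Adj v x)

/-- `M` is a nontrivial module: a module with more than one vertex that is not the whole vertex
set. -/
def IsNontrivialModule (G : SimpleGraph V) (M : Set V) : Prop :=
  IsModule G M ∧ M.Nontrivial ∧ M ≠ Set.univ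

/-- `G` is reduced: it is prereduced and every nontrivial module induces a clique. -/
def IsReduced (G : SimpleGraph V) : Prop :=
  IsPrereduced G ∧ ∀ M : Set V, IsNontrivialModule G M → G.IsClique M

/-- `v` is simplicial: its neighbors induce a clique. -/
def IsSimplicial (G : SimpleGraph V) (v : V) : Prop :=
  G.IsClique (G.neighborSet v)

/-- `x` and `y` are connected by a path that avoids the neighborhood of `z`. -/
def ConnectedAvoiding (G : SimpleGraph V) (x y z : V) : Prop :=
  ∃ p : G.Walk x y, p.IsPath ∧ ∀ v ∈ p.support, ¬ G.Adj z v

/-- `x, y, z` form an asteroidal triple: three vertices such that each pair of them is connected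
by a path that avoids the neighborhood of the third one. -/
def IsAsteroidalTriple (G : SimpleGraph V) (x y z : V) : Prop :=
  (x ≠ y ∧ y ≠ z ∧ x ≠ z) ∧
    ConnectedAvoiding G x y z ∧ ConnectedAvoiding G y z x ∧ ConnectedAvoiding G x z y

/-- The vertices of the †-asteroidal witness with base `b 1, …, b d`; the vertices `b 0` and
`b (d + 1)` are the base terminals (also called `l` and `r`). -/
inductive DaggerVertex (d : ℕ) : Type
  | s : DaggerVertex d
  | c : DaggerVertex d
  | b (i : Fin (d + 2)) : DaggerVertex d

/-- The edges of the †-asteroidal witness, each listed in one direction: `b 0, …, b (d + 1)` is a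
path, `c` is adjacent to `s` and to each of `b 1, …, b d`. -/
def DaggerRel (d : ℕ) : DaggerVertex d → DaggerVertex d → Prop
  | .s, .c => True
  | .c, .b i => 1 ≤ i.val ∧ i.val ≤ d
  | .b i, .b j => i.val + 1 = j.val
  | _, _ => False

/-- The †-asteroidal witness with `d` base vertices, as an abstract graph. -/
def daggerGraph (d : ℕ) : SimpleGraph (DaggerVertex d) :=
  SimpleGraph.fromRel (DaggerRel d)

/-- The vertices of the ‡-asteroidal witness with base `b 1, …, b d`; the vertices `b 0` and
`b (d + 1)` are the base terminals (also called `l` and `r`). -/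
inductive DDaggerVertex (d : ℕ) : Type
  | s : DDaggerVertex d
  | c₁ : DDaggerVertex d
  | c₂ : DDaggerVertex d
  | b (i : Fin (d + 2)) : DDaggerVertex d

/-- The edges of the ‡-asteroidal witness, each listed in one direction: `b 0, …, b (d + 1)` is a
path, `s, c₁, c₂` is a triangle, `c₁` is adjacent to `b 0, …, b d`, and `c₂` is adjacent to
`b 1, …, b (d + 1)`. -/
def DDaggerRel (d : ℕ) : DDaggerVertex d → DDaggerVertex d → Prop
  | .s, .c₁ => True
  | .s, .c₂ => True
  | .c₁, .c₂ => True
  | .c₁, .b i => i.val ≤ d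
  | .c₂, .b i => 1 ≤ i.val
  | .b i, .b j => i.val + 1 = j.val
  | _, _ => False

/-- The ‡-asteroidal witness with `d` base vertices, as an abstract graph. -/
def ddaggerGraph (d : ℕ) : SimpleGraph (DDaggerVertex d) :=
  SimpleGraph.fromRel (DDaggerRel d)

/-- The vertex set `W` induces a †-asteroidal witness in `G`. -/
def IsDaggerAW (G : SimpleGraph V) (W : Set V) : Prop :=
  ∃ d : ℕ, 3 ≤ d ∧ Nonempty (G.induce W ≃g daggerGraph d)

/-- The vertex set `W` induces a ‡-asteroidal witness in `G`. -/
def IsDDaggerAW (G : SimpleGraph V) (W : Set V) : Prop :=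
  ∃ d : ℕ, 2 ≤ d ∧ Nonempty (G.induce W ≃g ddaggerGraph d)

/-- `x` is a terminal of `W`: a member of an asteroidal triple of the subgraph induced by `W`. -/
def IsTerminal (G : SimpleGraph V) (W : Set V) (x : V) : Prop :=
  ∃ (hx : x ∈ W) (y z : W), IsAsteroidalTriple (G.induce W) ⟨x, hx⟩ y z

/-- The vertex set `X` induces a path (with at least one vertex). -/
def InducesPath (G : SimpleGraph V) (X : Set V) : Prop :=
  ∃ n : ℕ, Nonempty (G.induce X ≃g SimpleGraph.pathGraph (n + 1))

/-- `x` is a shallow terminal of the †- or ‡-asteroidal witness `W`: a terminal of `W` such that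
`W - N[x]` is an induced path. -/
def IsShallowTerminalOf (G : SimpleGraph V) (W : Set V) (x : V) : Prop :=
  (IsDaggerAW G W ∨ IsDDaggerAW G W) ∧ IsTerminal G W x ∧
    InducesPath G (W \ (insert x (G.neighborSet x)))

end IntervalDeletion

/-!
A graph whose induced subgraphs on at most ten vertices are all interval graphs has no asteroidal
triple whose connecting walks stay within ten vertices, and no induced 4-cycle. Take a witness with
foot `s`. A neighbor of `s` that meets the path `b 0, …, b (d + 1)` without being complete to the
base `b 1, …, b d` cuts out a witness with foot `s` and a shorter base. Once the base cannot be
shortened in this way, every neighbor of `s` is complete to the base or misses the path, and in the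
latter case it can replace `s` as a foot. Every foot is adjacent to every vertex complete to the
base, so the feet form a module, which is a clique because the graph is reduced. The vertices
complete to the base form a clique because there is no induced 4-cycle. The neighbors of `s` lie in
the union of these two cliques, which are complete to each other.
-/

namespace IntervalDeletion

variable {V W : Type*} {G : SimpleGraph V} {H : SimpleGraph W}

/-- `v ↦ [a v, b v]` is an interval model of `G`; that two intervals meet is expressed by
comparing their endpoints. -/
structure IsIntervalModel (G : SimpleGraph V) (a b : V → ℝ) : Prop where
  le (v : V) : a v ≤ b v
  adj_iff {u v : V} (huv : u ≠ v) : G.Adj u v ↔ a u ≤ b v ∧ a v ≤ b u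

theorem IsIntervalGraph.exists_isIntervalModel (h : IsIntervalGraph G) :
    ∃ a b, IsIntervalModel G a b := by
  obtain ⟨a, b, hle, hadj⟩ := h
  refine ⟨a, b, hle, fun {u v} huv => ?_⟩
  rw [hadj u v huv, Set.Icc_inter_Icc, Set.nonempty_Icc, sup_le_iff, le_inf_iff, le_inf_iff]
  have hu := hle u
  have hv := hle v
  tauto

namespace IsIntervalModel

variable {a b : V → ℝ} {m u v : V}

theorem lt_or_lt_of_not_adj (h : IsIntervalModel G a b) (huv : u ≠ v) (hadj : ¬ G.Adj u v) :
    b u < a v ∨ b v < a u := by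
  rw [h.adj_iff huv, not_and_or, not_le, not_le] at hadj
  exact hadj.symm

theorem same_side_of_walk (h : IsIntervalModel G a b) (p : G.Walk u v) (hu : u ≠ m)
    (hp : ∀ w ∈ p.support, ¬ G.Adj m w) :
    (b u < a m ∧ b v < a m) ∨ (b m < a u ∧ b m < a v) := by
  induction p with
  | nil => simpa using h.lt_or_lt_of_not_adj hu fun hadj => hp _ (by simp) hadj.symm
  | @cons u w v huw p ih =>
    have hmu : ¬ G.Adj m u := hp u (by simp)
    have hw : w ≠ m := fun hwm => hmu (hwm ▸ huw.symm)
    have hside_u := h.lt_or_lt_of_not_adj hu fun hadj => hmu hadj.symm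
    have hside_w := ih hw fun x hx => hp x (by simp [hx])
    have hmeet := (h.adj_iff huw.ne).1 huw
    have hm := h.le m
    grind

end IsIntervalModel

theorem IsIntervalGraph.not_isAsteroidalTriple (h : IsIntervalGraph G) (x y z : V) :
    ¬ IsAsteroidalTriple G x y z := by
  rintro ⟨⟨hxy, -, hxz⟩, ⟨p, -, hp⟩, ⟨q, -, hq⟩, ⟨r, -, hr⟩⟩
  obtain ⟨a, b, hab⟩ := h.exists_isIntervalModel
  have hx := hab.le x
  have hy := hab.le y
  have hz := hab.le z
  -- Each of three disjoint intervals would have the other two on one side; the middle one does not.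
  rcases hab.same_side_of_walk p hxz hp with ⟨_, _⟩ | ⟨_, _⟩ <;>
  rcases hab.same_side_of_walk q hxy.symm hq with ⟨_, _⟩ | ⟨_, _⟩ <;>
  rcases hab.same_side_of_walk r hxy hr with ⟨_, _⟩ | ⟨_, _⟩ <;>
  linarith

theorem IsIntervalGraph.isClique_commonNeighbors (h : IsIntervalGraph G) {u v : V} (huv : u ≠ v)
    (hadj : ¬ G.Adj u v) : G.IsClique (G.commonNeighbors u v) := by
  obtain ⟨a, b, hab⟩ := h.exists_isIntervalModel
  rintro x ⟨hux, hvx⟩ y ⟨huy, hvy⟩ hxy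
  have h₁ := (hab.adj_iff hux.ne).1 hux
  have h₂ := (hab.adj_iff hvx.ne).1 hvx
  have h₃ := (hab.adj_iff huy.ne).1 huy
  have h₄ := (hab.adj_iff hvy.ne).1 hvy
  rw [hab.adj_iff hxy]
  -- Both intervals cover the gap between the disjoint intervals of `u` and `v`.
  rcases hab.lt_or_lt_of_not_adj huv hadj with hlt | hlt <;> constructor <;> linarith

theorem connectedAvoiding_induce {F : Set V} {x y z : V} (p : G.Walk x y)
    (hp : ∀ v ∈ p.support, v ∈ F ∧ ¬ G.Adj z v) (hz : z ∈ F) :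
    ConnectedAvoiding (G.induce F) ⟨x, (hp x p.start_mem_support).1⟩
      ⟨y, (hp y p.end_mem_support).1⟩ ⟨z, hz⟩ := by
  classical
  let p' := p.induce F fun v hv => (hp v hv).1
  refine ⟨p'.bypass, p'.bypass_isPath, fun v hv => ?_⟩
  have hv' := p'.support_bypass_subset_support hv
  rw [SimpleGraph.Walk.support_induce] at hv'
  exact (hp v ((List.mem_attachWith _ _).1 hv')).2

namespace IsPrereduced

theorem isIntervalGraph_induce (hG : IsPrereduced G) {F : Set V} (hF : F.encard ≤ 10) :
    IsIntervalGraph (G.induce F) := by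
  by_contra hn
  have hfin : F.Finite := Set.finite_of_encard_le_coe hF
  obtain ⟨X, -, hX⟩ := (hfin.finite_subsets.subset (Set.sep_subset _
    fun Y => ¬ IsIntervalGraph (G.induce Y))).exists_le_minimal ⟨Set.Subset.rfl, hn⟩
  refine hG X ⟨hX.prop.2, fun Y hYX => by_contra fun hY => ?_⟩
    ((Set.encard_le_encard hX.prop.1).trans hF)
  exact hX.not_lt (show Y ∈ {Y ∈ {Y | Y ⊆ F} | _} from ⟨hYX.subset.trans hX.prop.1, hY⟩) hYX

theorem isIntervalGraph_induce_list (hG : IsPrereduced G) {L : List V} (hL : L.length ≤ 10) :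
    IsIntervalGraph (G.induce {v | v ∈ L}) := by
  classical
  apply hG.isIntervalGraph_induce
  rw [← L.coe_toFinset, Set.encard_coe_eq_coe_finsetCard]
  exact_mod_cast L.toFinset_card_le.trans hL

/-- Listing the vertices of the three walks allows them to overlap within the bound of ten. -/
theorem false_of_asteroidal_walks (hG : IsPrereduced G) {L : List V} (hL : L.length ≤ 10)
    {x y z : V} (hxy : x ≠ y) (hyz : y ≠ z) (hxz : x ≠ z)
    (p : G.Walk x y) (q : G.Walk y z) (r : G.Walk x z)
    (hp : ∀ v ∈ p.support, v ∈ L ∧ ¬ G.Adj z v) (hq : ∀ v ∈ q.support, v ∈ L ∧ ¬ G.Adj x v)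
    (hr : ∀ v ∈ r.support, v ∈ L ∧ ¬ G.Adj y v) : False :=
  (hG.isIntervalGraph_induce_list hL).not_isAsteroidalTriple _ _ _
    ⟨⟨Subtype.coe_ne_coe.1 hxy, Subtype.coe_ne_coe.1 hyz, Subtype.coe_ne_coe.1 hxz⟩,
      connectedAvoiding_induce p hp (hq z q.end_mem_support).1,
      connectedAvoiding_induce q hq (hp x p.start_mem_support).1,
      connectedAvoiding_induce r hr (hp y p.end_mem_support).1⟩

theorem isClique_commonNeighbors (hG : IsPrereduced G) {u v : V} (huv : u ≠ v)
    (hadj : ¬ G.Adj u v) : G.IsClique (G.commonNeighbors u v) := by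
  intro x hx y hy hxy
  have h := hG.isIntervalGraph_induce_list (L := [u, v, x, y]) (by simp)
  exact h.isClique_commonNeighbors (u := ⟨u, by simp⟩) (v := ⟨v, by simp⟩)
    (Subtype.coe_ne_coe.1 huv) hadj (x := ⟨x, by simp⟩) hx (y := ⟨y, by simp⟩) hy
    (Subtype.coe_ne_coe.1 hxy)

end IsPrereduced

/-- `b 0, …, b n` is an induced path of `G`; the values of `b` beyond `n` are irrelevant.
Consecutive adjacency and non-adjacency already force the vertices to be distinct if `3 ≤ n`. -/
def IsInducedPath (G : SimpleGraph V) (b : ℕ → V) (n : ℕ) : Prop :=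
  ∀ ⦃i j⦄, i ≤ n → j ≤ n → (G.Adj (b i) (b j) ↔ i + 1 = j ∨ j + 1 = i)

namespace IsInducedPath

variable {b : ℕ → V} {n : ℕ}

theorem adj_iff (hb : IsInducedPath G b n) {i j : ℕ} (hi : i ≤ n) (hj : j ≤ n) :
    G.Adj (b i) (b j) ↔ i + 1 = j ∨ j + 1 = i :=
  hb hi hj

theorem adj_succ (hb : IsInducedPath G b n) {i : ℕ} (hi : i < n) : G.Adj (b i) (b (i + 1)) :=
  (hb hi.le hi).2 (Or.inl rfl)

theorem injOn (hb : IsInducedPath G b n) (hn : 3 ≤ n) : Set.InjOn b (Set.Iic n) := by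
  suffices h : ∀ i j, i < j → j ≤ n → b i ≠ b j by
    intro i hi j hj hij
    by_contra hne
    rcases lt_or_gt_of_ne hne with hlt | hlt
    · exact h i j hlt hj hij
    · exact h j i hlt hi hij.symm
  intro i j hij hj heq
  -- Some vertex of the path is adjacent to exactly one of `b i` and `b j`.
  have hadj : ∀ k ≤ n, (i + 1 = k ∨ k + 1 = i) ↔ (j + 1 = k ∨ k + 1 = j) := fun k hk => by
    rw [← hb (hij.le.trans hj) hk, ← hb hj hk, heq]
  have h₁ := hadj (i - 1) (by omega)
  have h₂ := hadj (i + 1) (by omega)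
  have h₃ := hadj (j + 1)
  omega

theorem ne_of_forall_not_adj (hb : IsInducedPath G b n) (hn : 1 ≤ n) {x : V}
    (hx : ∀ i ≤ n, ¬ G.Adj x (b i)) {i : ℕ} (hi : i ≤ n) : x ≠ b i := by
  rintro rfl
  rcases hi.lt_or_eq with hlt | rfl
  · exact hx (i + 1) hlt (hb.adj_succ hlt)
  · exact hx (i - 1) (by omega) ((hb le_rfl (by omega)).2 (by omega))

theorem reverse (hb : IsInducedPath G b n) : IsInducedPath G (fun i => b (n - i)) n := by
  intro i j hi hj
  rw [hb (by omega) (by omega)]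
  omega

theorem shift (hb : IsInducedPath G b n) {k m : ℕ} (hkm : k + m ≤ n) :
    IsInducedPath G (fun i => b (k + i)) m := by
  intro i j hi hj
  rw [hb (by omega) (by omega)]
  omega

theorem exists_walk (hb : IsInducedPath G b n) :
    ∃ p : G.Walk (b 0) (b n), ∀ v ∈ p.support, ∃ i ≤ n, b i = v := by
  suffices h : ∀ m ≤ n, ∃ p : G.Walk (b 0) (b m), ∀ v ∈ p.support, ∃ i ≤ n, b i = v from
    h n le_rfl
  intro m hm
  induction m with
  | zero => exact ⟨.nil, fun v hv => ⟨0, hm, (SimpleGraph.Walk.mem_support_nil_iff.1 hv).symm⟩⟩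
  | succ m ih =>
    obtain ⟨p, hp⟩ := ih (Nat.le_of_succ_le hm)
    refine ⟨p.concat (hb.adj_succ hm), fun v hv => ?_⟩
    rw [SimpleGraph.Walk.support_concat, List.mem_append, List.mem_singleton] at hv
    rcases hv with hv | rfl
    · exact hp v hv
    · exact ⟨m + 1, hm, rfl⟩

end IsInducedPath

theorem exists_first_run {P : ℕ → Prop} {i j : ℕ} (hij : i ≤ j) (hi : P i) (hj : ¬ P j) :
    ∃ p q, p ≤ q ∧ q < j ∧ (∀ k < p, ¬ P k) ∧ (∀ k, p ≤ k → k ≤ q → P k) ∧ ¬ P (q + 1) := by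
  classical
  have henter : ∃ p, P p := ⟨i, hi⟩
  have hpi : Nat.find henter ≤ i := Nat.find_min' henter hi
  have hleave : ∃ r, Nat.find henter ≤ r ∧ ¬ P r := ⟨j, hpi.trans hij, hj⟩
  obtain ⟨hpr, hr⟩ := Nat.find_spec hleave
  have hlt : Nat.find henter < Nat.find hleave :=
    hpr.lt_of_ne fun h => hr (h ▸ Nat.find_spec henter)
  have hrj : Nat.find hleave ≤ j := Nat.find_min' hleave ⟨hpi.trans hij, hj⟩
  refine ⟨Nat.find henter, Nat.find hleave - 1, by omega, by omega,
    fun k hk => Nat.find_min henter hk, fun k hpk hk => ?_, ?_⟩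
  · by_contra hPk
    exact Nat.find_min hleave (by omega) ⟨hpk, hPk⟩
  · rwa [Nat.sub_add_cancel (by omega)]

/-- The vertices complete to the base `b 1, …, b d`. -/
def baseNeighbors (G : SimpleGraph V) (b : ℕ → V) (d : ℕ) : Set V :=
  {x | ∀ j, 1 ≤ j → j ≤ d → G.Adj x (b j)}

/-- The features that the †-witness (with `c₁ = c₂`) and the ‡-witness have in common: the path
`b 0, …, b (d + 1)` is induced and misses `s`, and `c₁`, `c₂` are neighbors of `s` complete to the
base. Whether `c₁` and `c₂` are adjacent, or `c₁` to `b 0`, or `c₂` to `b (d + 1)`, is left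
open. -/
structure LooseWitness (G : SimpleGraph V) (s c₁ c₂ : V) (b : ℕ → V) (d : ℕ) : Prop where
  two_le : 2 ≤ d
  path : IsInducedPath G b (d + 1)
  not_adj : ∀ i ≤ d + 1, ¬ G.Adj s (b i)
  adj₁ : G.Adj s c₁
  adj₂ : G.Adj s c₂
  mem₁ : c₁ ∈ baseNeighbors G b d
  mem₂ : c₂ ∈ baseNeighbors G b d
  not_adj₁ : ¬ G.Adj c₁ (b (d + 1))
  not_adj₂ : ¬ G.Adj c₂ (b 0)

namespace LooseWitness

variable {s c₁ c₂ x y : V} {b : ℕ → V} {d : ℕ}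

theorem reverse (h : LooseWitness G s c₁ c₂ b d) :
    LooseWitness G s c₂ c₁ (fun i => b (d + 1 - i)) d where
  two_le := h.two_le
  path := h.path.reverse
  not_adj i _ := h.not_adj _ (by omega)
  adj₁ := h.adj₂
  adj₂ := h.adj₁
  mem₁ i h₁ h₂ := h.mem₂ _ (by omega) (by omega)
  mem₂ i h₁ h₂ := h.mem₁ _ (by omega) (by omega)
  not_adj₁ := by simpa using h.not_adj₂
  not_adj₂ := by simpa using h.not_adj₁

theorem map (e : G ↪g H) (h : LooseWitness G s c₁ c₂ b d) :
    LooseWitness H (e s) (e c₁) (e c₂) (e ∘ b) d where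
  two_le := h.two_le
  path _ _ hi hj := e.map_adj_iff.trans (h.path hi hj)
  not_adj i hi := e.map_adj_iff.not.2 (h.not_adj i hi)
  adj₁ := e.map_adj_iff.2 h.adj₁
  adj₂ := e.map_adj_iff.2 h.adj₂
  mem₁ j h₁ h₂ := e.map_adj_iff.2 (h.mem₁ j h₁ h₂)
  mem₂ j h₁ h₂ := e.map_adj_iff.2 (h.mem₂ j h₁ h₂)
  not_adj₁ := e.map_adj_iff.not.2 h.not_adj₁
  not_adj₂ := e.map_adj_iff.not.2 h.not_adj₂

theorem base_not_adj (h : LooseWitness G s c₁ c₂ b d) {i : ℕ} (hi : i ≤ d + 1) :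
    ¬ G.Adj (b i) s :=
  fun hadj => h.not_adj i hi hadj.symm

theorem ne_base (h : LooseWitness G s c₁ c₂ b d) {i : ℕ} (hi : i ≤ d + 1) : s ≠ b i :=
  h.path.ne_of_forall_not_adj (by omega) h.not_adj hi

theorem base_ne_base (h : LooseWitness G s c₁ c₂ b d) {i j : ℕ} (hi : i ≤ d + 1) (hj : j ≤ d + 1)
    (hij : i ≠ j) : b i ≠ b j :=
  (h.path.injOn (by have := h.two_le; omega)).ne hi hj hij

theorem adj_of_adj_ends (hG : IsPrereduced G) (h : LooseWitness G s c₁ c₂ b d) (p : G.Walk x s)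
    (hlen : p.length ≤ 2) (hp : ∀ v ∈ p.support, ∀ i ≤ d + 1, ¬ G.Adj v (b i))
    (hy₁ : G.Adj y (b 1)) (hyd : G.Adj y (b d)) : G.Adj x y := by
  by_contra hxy
  have hd := h.two_le
  have hx := hp x p.start_mem_support
  have hp' : ∀ v ∈ p.support, ∀ i ≤ d + 1, ¬ G.Adj (b i) v :=
    fun v hv i hi hadj => hp v hv i hi hadj.symm
  have h₁ := h.mem₁ 1 le_rfl (by omega)
  have h₂ := h.mem₂ d (by omega) le_rfl
  have hb₀ := h.path.adj_succ (i := 0) (by omega)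
  have hbd := h.path.adj_succ (i := d) (by omega)
  have hc₁ := mt SimpleGraph.Adj.symm h.not_adj₁
  have hc₂ := mt SimpleGraph.Adj.symm h.not_adj₂
  apply hG.false_of_asteroidal_walks (L := p.support ++ [y, c₁, c₂, b 0, b 1, b d, b (d + 1)])
    (by simp; omega)
    (h.path.ne_of_forall_not_adj (by omega) hx (by omega))
    (h.base_ne_base (by omega) le_rfl (by omega))
    (h.path.ne_of_forall_not_adj (by omega) hx le_rfl)
    (p.append (.cons h.adj₁ (.cons h₁ (.cons hb₀.symm .nil))))
    (.cons hb₀ (.cons hy₁.symm (.cons hyd (.cons hbd .nil))))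
    (p.append (.cons h.adj₂ (.cons h₂ (.cons hbd .nil))))
  · intro v hv
    rw [SimpleGraph.Walk.mem_support_append_iff] at hv
    rcases hv with hv | hv
    · exact ⟨by simp [hv], hp' v hv _ le_rfl⟩
    · revert v
      simp (disch := omega) [*, h.path.adj_iff, h.base_not_adj]
      omega
  · simp [*]
  · intro v hv
    rw [SimpleGraph.Walk.mem_support_append_iff] at hv
    rcases hv with hv | hv
    · exact ⟨by simp [hv], hp' v hv _ (by omega)⟩
    · revert v
      simp (disch := omega) [*, h.path.adj_iff, h.base_not_adj]
      omega

theorem adj_of_mem_baseNeighbors (hG : IsPrereduced G) (h : LooseWitness G s c₁ c₂ b d)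
    (hy : y ∈ baseNeighbors G b d) : G.Adj s y := by
  have hd := h.two_le
  exact h.adj_of_adj_ends hG .nil (by simp) (by simpa using h.not_adj) (hy 1 le_rfl (by omega))
    (hy d (by omega) le_rfl)

theorem of_adj (hG : IsPrereduced G) (h : LooseWitness G s c₁ c₂ b d) (hsx : G.Adj s x)
    (hx : ∀ i ≤ d + 1, ¬ G.Adj x (b i)) : LooseWitness G x c₁ c₂ b d := by
  have hd := h.two_le
  have hadj {y} (hy : y ∈ baseNeighbors G b d) : G.Adj x y :=
    h.adj_of_adj_ends hG (.cons hsx.symm .nil) (by simp)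
      (by simpa using ⟨hx, h.not_adj⟩)
      (hy 1 le_rfl (by omega)) (hy d (by omega) le_rfl)
  exact { h with not_adj := hx, adj₁ := hadj h.mem₁, adj₂ := hadj h.mem₂ }

theorem six_le (hG : IsPrereduced G) (h : LooseWitness G s c₁ c₂ b d) : 6 ≤ d := by
  by_contra! hlt
  have hd := h.two_le
  have h₁ := h.mem₁ 1 le_rfl (by omega)
  have h₂ := h.mem₂ d (by omega) le_rfl
  have hb₀ := h.path.adj_succ (i := 0) (by omega)
  have hbd := h.path.adj_succ (i := d) (by omega)
  have hc₁ := mt SimpleGraph.Adj.symm h.not_adj₁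
  have hc₂ := mt SimpleGraph.Adj.symm h.not_adj₂
  have hmem : ∀ i ≤ d + 1, ∃ a < d + 2, b a = b i := fun i hi => ⟨i, by omega, rfl⟩
  obtain ⟨q, hq⟩ := h.path.exists_walk
  apply hG.false_of_asteroidal_walks (L := s :: c₁ :: c₂ :: (List.range (d + 2)).map b)
    (by simp; omega) (h.ne_base (by omega)) (h.base_ne_base (by omega) le_rfl (by omega))
    (h.ne_base le_rfl)
    (.cons h.adj₁ (.cons h₁ (.cons hb₀.symm .nil))) q
    (.cons h.adj₂ (.cons h₂ (.cons hbd .nil)))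
  · simp (disch := omega) [*, h.path.adj_iff, h.base_not_adj]
    omega
  · intro v hv
    obtain ⟨i, hi, rfl⟩ := hq v hv
    exact ⟨by simp [hmem i hi], h.not_adj i hi⟩
  · simp (disch := omega) [*, h.path.adj_iff, h.base_not_adj]
    omega

theorem isClique_baseNeighbors (hG : IsPrereduced G) (h : LooseWitness G s c₁ c₂ b d) :
    G.IsClique (baseNeighbors G b d) := by
  have hd := h.six_le hG
  refine (hG.isClique_commonNeighbors (u := b 1) (v := b 3) (h.base_ne_base (by omega)
    (by omega) (by omega)) (by rw [h.path.adj_iff] <;> omega)).subset fun x hx => ?_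
  exact ⟨(hx 1 (by omega) (by omega)).symm, (hx 3 (by omega) (by omega)).symm⟩

theorem adj_two_of_adj_zero (hG : IsPrereduced G) (h : LooseWitness G s c₁ c₂ b d)
    (hsx : G.Adj s x) (hx : G.Adj x (b 0)) : G.Adj x (b 2) := by
  by_contra hx₂
  have hd := h.six_le hG
  have hb₀ := h.path.adj_succ (i := 0) (by omega)
  have hb₁ := h.path.adj_succ (i := 1) (by omega)
  have h₂ := h.mem₂ 2 (by omega) (by omega)
  have hc₂ := mt SimpleGraph.Adj.symm h.not_adj₂
  have hx₂' := mt SimpleGraph.Adj.symm hx₂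
  apply hG.false_of_asteroidal_walks (L := [s, x, c₂, b 0, b 1, b 2]) (by simp)
    (h.ne_base (by omega)) (h.base_ne_base (by omega) (by omega) (by omega)) (h.ne_base (by omega))
    (.cons hsx (.cons hx .nil)) (.cons hb₀ (.cons hb₁ .nil)) (.cons h.adj₂ (.cons h₂ .nil))
  all_goals simp (disch := omega) [*, h.path.adj_iff, h.base_not_adj, h.not_adj]

theorem adj_of_adj_of_adj (hG : IsPrereduced G) (h : LooseWitness G s c₁ c₂ b d)
    (hsx : G.Adj s x) {k : ℕ} (hk : k + 1 ≤ d) (hx : G.Adj x (b k)) (hx' : G.Adj x (b (k + 2))) :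
    G.Adj x (b (k + 1)) := by
  refine hG.isClique_commonNeighbors
    (h.base_ne_base (i := k) (j := k + 2) (by omega) (by omega) (by omega))
    (by rw [h.path.adj_iff] <;> omega) ⟨hx.symm, hx'.symm⟩
    ⟨h.path.adj_succ (by omega), (h.path.adj_succ (by omega)).symm⟩ ?_
  rintro rfl
  exact h.not_adj _ (by omega) hsx

theorem adj_two_of_adj_one (hG : IsPrereduced G) (h : LooseWitness G s c₁ c₂ b d)
    (hsx : G.Adj s x) (hx₁ : G.Adj x (b 1)) : G.Adj x (b 2) := by
  by_contra hx₂
  have hd := h.six_le hG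
  have hx₃ : ¬ G.Adj (b 3) x := fun hx₃ =>
    hx₂ (h.adj_of_adj_of_adj hG hsx (by omega) hx₁ hx₃.symm)
  have hb₀ : G.Adj (b 0) (b 1) := h.path.adj_succ (by omega)
  have hb₁ : G.Adj (b 1) (b 2) := h.path.adj_succ (by omega)
  have hb₂ : G.Adj (b 2) (b 3) := h.path.adj_succ (by omega)
  have hc₃ := h.mem₂ 3 (by omega) (by omega)
  have hc₀ := mt SimpleGraph.Adj.symm h.not_adj₂
  apply hG.false_of_asteroidal_walks (L := [s, x, c₂, b 0, b 1, b 2, b 3]) (by simp)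
    (h.ne_base (by omega)) (h.base_ne_base (by omega) (by omega) (by omega)) (h.ne_base (by omega))
    (.cons hsx (.cons hx₁ (.cons hb₀.symm .nil))) (.cons hb₀ (.cons hb₁ (.cons hb₂ .nil)))
    (.cons h.adj₂ (.cons hc₃ .nil))
  all_goals simp (disch := omega) [*, h.path.adj_iff, h.base_not_adj, h.not_adj]

theorem adj_add_two (hG : IsPrereduced G) (h : LooseWitness G s c₁ c₂ b d) (hsx : G.Adj s x)
    {k : ℕ} (hk : k + 1 < d) (hx₁ : G.Adj x (b (k + 1))) (hx₀ : ¬ G.Adj x (b k)) :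
    G.Adj x (b (k + 2)) := by
  obtain _ | j := k
  · exact h.adj_two_of_adj_one hG hsx hx₁
  by_contra hx₂
  have hxj : ¬ G.Adj (b j) x := fun hxj =>
    hx₀ (h.adj_of_adj_of_adj hG hsx (by omega) hxj.symm hx₁)
  have hx₃ : ¬ G.Adj (b (j + 4)) x := fun hx₃ =>
    hx₂ (h.adj_of_adj_of_adj hG hsx (k := j + 2) (by omega) hx₁ hx₃.symm)
  have hb₀ : G.Adj (b j) (b (j + 1)) := h.path.adj_succ (by omega)
  have hb₁ : G.Adj (b (j + 1)) (b (j + 2)) := h.path.adj_succ (by omega)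
  have hb₂ : G.Adj (b (j + 2)) (b (j + 3)) := h.path.adj_succ (by omega)
  have hb₃ : G.Adj (b (j + 3)) (b (j + 4)) := h.path.adj_succ (by omega)
  apply hG.false_of_asteroidal_walks
    (L := [s, x, b j, b (j + 1), b (j + 2), b (j + 3), b (j + 4)]) (by simp)
    (h.ne_base (by omega)) (h.base_ne_base (by omega) (by omega) (by omega))
    (h.ne_base (by omega))
    (.cons hsx (.cons hx₁ (.cons hb₁.symm (.cons hb₀.symm .nil))))
    (.cons hb₀ (.cons hb₁ (.cons hb₂ (.cons hb₃ .nil))))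
    (.cons hsx (.cons hx₁ (.cons hb₂ (.cons hb₃ .nil))))
  all_goals simp (disch := omega) [*, h.path.adj_iff, h.base_not_adj, h.not_adj]
  all_goals omega

theorem restrict_left (h : LooseWitness G s c₁ c₂ b d) (hsx : G.Adj s x) {q : ℕ} (hq : 2 ≤ q)
    (hqd : q ≤ d) (hmem : x ∈ baseNeighbors G b q) (hx : ¬ G.Adj x (b (q + 1))) :
    LooseWitness G s x c₂ b q where
  two_le := hq
  path _ _ hi hj := h.path (by omega) (by omega)
  not_adj i hi := h.not_adj i (by omega)
  adj₁ := hsx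
  adj₂ := h.adj₂
  mem₁ := hmem
  mem₂ k hk hkq := h.mem₂ k hk (by omega)
  not_adj₁ := hx
  not_adj₂ := h.not_adj₂

theorem restrict (h : LooseWitness G s c₁ c₂ b d) (hsx : G.Adj s x) {k m : ℕ} (hm : 2 ≤ m)
    (hkm : k + m ≤ d) (hmem : x ∈ baseNeighbors G (fun i => b (k + i)) m)
    (hx₀ : ¬ G.Adj x (b k)) (hx : ¬ G.Adj x (b (k + (m + 1)))) :
    LooseWitness G s x x (fun i => b (k + i)) m where
  two_le := hm
  path := h.path.shift (by omega)
  not_adj _ _ := h.not_adj _ (by omega)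
  adj₁ := hsx
  adj₂ := hsx
  mem₁ := hmem
  mem₂ := hmem
  not_adj₁ := hx
  not_adj₂ := hx₀

/-- If the first run of neighbors of `x` on the path starts at `b 0`, then `x` can replace `c₁`;
otherwise `x` can replace both `c₁` and `c₂`. -/
theorem exists_smaller_of_lt (hG : IsPrereduced G) (h : LooseWitness G s c₁ c₂ b d)
    (hsx : G.Adj s x) {i j : ℕ} (hij : i < j) (hj : j ≤ d) (hxi : G.Adj x (b i))
    (hxj : ¬ G.Adj x (b j)) :
    ∃ c b' d', d' < d ∧ LooseWitness G s x c b' d' ∧ ∀ m ≤ d' + 1, ∃ k ≤ d + 1, b' m = b k := by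
  have hd := h.six_le hG
  obtain ⟨p, q, hpq, hqj, hp, hadj, hq⟩ :=
    exists_first_run (P := fun k => G.Adj x (b k)) hij.le hxi hxj
  obtain _ | k := p
  · have hx₀ : G.Adj x (b 0) := hadj 0 le_rfl hpq
    have hx₂ := h.adj_two_of_adj_zero hG hsx hx₀
    have hx₁ := h.adj_of_adj_of_adj hG hsx (by omega) hx₀ hx₂
    have hq₂ : 2 ≤ q := by
      by_contra! hlt
      interval_cases q
      exacts [hq hx₁, hq hx₂]
    exact ⟨c₂, b, q, by omega,
      h.restrict_left hsx hq₂ (by omega) (fun k _ hk => hadj k (by omega) hk) hq,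
      fun m hm => ⟨m, by omega, rfl⟩⟩
  · have hx₀ : ¬ G.Adj x (b k) := hp k k.lt_succ_self
    have hx₂ : G.Adj x (b (k + 2)) := h.adj_add_two hG hsx (by omega) (hadj _ le_rfl hpq) hx₀
    have hq₂ : q ≠ k + 1 := fun hqk => hq (hqk ▸ hx₂)
    exact ⟨x, fun i => b (k + i), q - k, by omega,
      h.restrict hsx (by omega) (by omega) (fun i _ _ => hadj _ (by omega) (by omega)) hx₀
        (by rwa [show k + (q - k + 1) = q + 1 by omega]),
      fun m hm => ⟨k + m, by omega, rfl⟩⟩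

theorem exists_smaller (hG : IsPrereduced G) (h : LooseWitness G s c₁ c₂ b d) (hsx : G.Adj s x)
    (hx : x ∉ baseNeighbors G b d) {i : ℕ} (hi : i ≤ d + 1) (hxi : G.Adj x (b i)) :
    ∃ c b' d', d' < d ∧ LooseWitness G s x c b' d' ∧ ∀ m ≤ d' + 1, ∃ k ≤ d + 1, b' m = b k := by
  obtain ⟨j, hj₁, hj, hxj⟩ : ∃ j, 1 ≤ j ∧ j ≤ d ∧ ¬ G.Adj x (b j) := by
    simpa [baseNeighbors] using hx
  rcases lt_trichotomy i j with hij | rfl | hij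
  · exact h.exists_smaller_of_lt hG hsx hij hj hxi hxj
  · exact absurd hxi hxj
  · obtain ⟨c, b', d', hd', h', hb'⟩ := h.reverse.exists_smaller_of_lt hG hsx
      (i := d + 1 - i) (j := d + 1 - j) (by omega) (by omega)
      (by rwa [Nat.sub_sub_self hi]) (by rwa [Nat.sub_sub_self (by omega)])
    refine ⟨c, b', d', hd', h', fun m hm => ?_⟩
    obtain ⟨k, -, hk⟩ := hb' m hm
    exact ⟨d + 1 - k, by omega, hk⟩

end LooseWitness

/-- A witness with which every neighbor of the foot is compatible: such a neighbor is complete to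
the base or misses the path `b 0, …, b (d + 1)`. -/
structure TightWitness (G : SimpleGraph V) (s c₁ c₂ : V) (b : ℕ → V) (d : ℕ) : Prop
    extends LooseWitness G s c₁ c₂ b d where
  tight : ∀ x, G.Adj s x → ∀ i ≤ d + 1, G.Adj x (b i) → x ∈ baseNeighbors G b d

theorem LooseWitness.exists_tightWitness (hG : IsPrereduced G) {s c₁ c₂ : V} {b : ℕ → V} {d : ℕ}
    (h : LooseWitness G s c₁ c₂ b d) : ∃ c₁ c₂ b d, TightWitness G s c₁ c₂ b d := by
  induction d using Nat.strong_induction_on generalizing c₁ c₂ b with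
  | _ d ih =>
    by_cases ht : ∀ x, G.Adj s x → ∀ i ≤ d + 1, G.Adj x (b i) → x ∈ baseNeighbors G b d
    · exact ⟨c₁, c₂, b, d, h, ht⟩
    · push Not at ht
      obtain ⟨x, hsx, i, hi, hxi, hx⟩ := ht
      obtain ⟨c, b', d', hd', h', -⟩ := h.exists_smaller hG hsx hx hi hxi
      exact ih d' hd' h'

namespace TightWitness

variable {s c₁ c₂ x : V} {b : ℕ → V} {d : ℕ}

theorem of_adj (hG : IsPrereduced G) (h : TightWitness G s c₁ c₂ b d) (hsx : G.Adj s x)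
    (hx : x ∉ baseNeighbors G b d) : TightWitness G x c₁ c₂ b d := by
  have hmiss : ∀ i ≤ d + 1, ¬ G.Adj x (b i) := fun i hi hxi => hx (h.tight x hsx i hi hxi)
  have hloose : LooseWitness G x c₁ c₂ b d := h.toLooseWitness.of_adj hG hsx hmiss
  refine ⟨hloose, fun y hxy i hi hyi => ?_⟩
  by_contra hy
  -- A smaller witness with foot `x` in which `y` is complete to the base also has `s` as a foot.
  obtain ⟨c, b', d', -, h', hb'⟩ := hloose.exists_smaller hG hxy hy hi hyi
  have hs : LooseWitness G s y c b' d' := h'.of_adj hG hsx.symm fun m hm => by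
    obtain ⟨k, hk, hmk⟩ := hb' m hm
    exact hmk ▸ h.not_adj k hk
  exact hy (h.tight y hs.adj₁ i hi hyi)

theorem isModule_setOf (hG : IsPrereduced G) : IsModule G {v | TightWitness G v c₁ c₂ b d} := by
  have hadj {u v x} (hu : TightWitness G u c₁ c₂ b d) (hv : TightWitness G v c₁ c₂ b d)
      (hx : ¬ TightWitness G x c₁ c₂ b d) (hux : G.Adj u x) : G.Adj v x :=
    hv.adj_of_mem_baseNeighbors hG (by_contra fun hxb => hx (hu.of_adj hG hux hxb))
  exact fun u hu v hv x hx => ⟨hadj hu hv hx, hadj hv hu hx⟩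

theorem isClique_setOf (hG : IsReduced G) : G.IsClique {v | TightWitness G v c₁ c₂ b d} := by
  obtain hM | hM := Set.subsingleton_or_nontrivial {v | TightWitness G v c₁ c₂ b d}
  · exact hM.pairwise _
  · refine hG.2 _ ⟨isModule_setOf hG.1, hM, fun huniv => ?_⟩
    have h₀ : TightWitness G (b 0) c₁ c₂ b d := huniv.ge (Set.mem_univ (b 0))
    exact h₀.not_adj 1 (by omega) (h₀.path.adj_succ (by omega))

theorem isSimplicial (hG : IsReduced G) (h : TightWitness G s c₁ c₂ b d) : IsSimplicial G s := by
  have hmem {x} (hx : G.Adj s x) : x ∈ baseNeighbors G b d ∨ TightWitness G x c₁ c₂ b d :=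
    or_iff_not_imp_left.2 (h.of_adj hG.1 hx)
  intro x hx y hy hxy
  rcases hmem hx with hxb | hxt <;> rcases hmem hy with hyb | hyt
  · exact h.isClique_baseNeighbors hG.1 hxb hyb hxy
  · exact (hyt.adj_of_mem_baseNeighbors hG.1 hxb).symm
  · exact hxt.adj_of_mem_baseNeighbors hG.1 hyb
  · exact isClique_setOf hG hxt hyt hxy

end TightWitness

namespace InducesPath

variable {X : Set V}

theorem comap {X : Set W} (hX : InducesPath H X) (e : G ↪g H)
    (hXe : X ⊆ Set.range e) : InducesPath G (e ⁻¹' X) := by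
  obtain ⟨n, ⟨f⟩⟩ := hX
  refine ⟨n, ⟨RelIso.trans ?_ f⟩⟩
  exact {
    toEquiv := Equiv.ofBijective (fun v : e ⁻¹' X => (⟨e v, v.2⟩ : X))
      ⟨fun u v huv => Subtype.ext (e.injective (congrArg Subtype.val huv)), fun ⟨w, hw⟩ => by
        obtain ⟨v, rfl⟩ := hXe hw
        exact ⟨⟨v, hw⟩, rfl⟩⟩
    map_rel_iff' := e.map_adj_iff }

theorem exists_adj (hX : InducesPath G X) (hnt : X.Nontrivial) {u : V} (hu : u ∈ X) :
    ∃ v ∈ X, G.Adj u v := by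
  obtain ⟨n, ⟨f⟩⟩ := hX
  have : Nontrivial X := hnt.coe_sort
  have hconn : (G.induce X).Connected := f.connected_iff.2 (SimpleGraph.pathGraph_connected n)
  obtain ⟨v, hv⟩ := hconn.preconnected.exists_adj_of_nontrivial ⟨u, hu⟩
  exact ⟨v, v.2, hv⟩

theorem not_triangle (hX : InducesPath G X) {u v w : V} (hu : u ∈ X) (hv : v ∈ X)
    (hw : w ∈ X) (huv : G.Adj u v) (hvw : G.Adj v w) : ¬ G.Adj u w := by
  intro huw
  obtain ⟨n, ⟨f⟩⟩ := hX
  have h₁ : (SimpleGraph.pathGraph (n + 1)).Adj (f ⟨u, hu⟩) (f ⟨v, hv⟩) := f.map_adj_iff.2 huv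
  have h₂ : (SimpleGraph.pathGraph (n + 1)).Adj (f ⟨v, hv⟩) (f ⟨w, hw⟩) := f.map_adj_iff.2 hvw
  have h₃ : (SimpleGraph.pathGraph (n + 1)).Adj (f ⟨u, hu⟩) (f ⟨w, hw⟩) := f.map_adj_iff.2 huw
  rw [SimpleGraph.pathGraph_adj] at h₁ h₂ h₃
  omega

end InducesPath

theorem IsTerminal.nontrivial {X : Set V} {x : V} (hx : IsTerminal G X x) :
    (X \ insert x (G.neighborSet x)).Nontrivial := by
  obtain ⟨hxX, y, z, ⟨hxy, hyz, hxz⟩, -, ⟨q, -, hq⟩, -⟩ := hx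
  have hmem {v : X} (hxv : ⟨x, hxX⟩ ≠ v) (hv : v ∈ q.support) :
      v.1 ∈ X \ insert x (G.neighborSet x) :=
    ⟨v.2, by simpa [Subtype.ext_iff, hxv.symm] using ⟨fun h => hxv (Subtype.ext h.symm), hq v hv⟩⟩
  exact ⟨y, hmem hxy q.start_mem_support, z, hmem hxz q.end_mem_support, Subtype.coe_ne_coe.2 hyz⟩

theorem IsShallowTerminalOf.exists_embedding {X : Set V} {x : V}
    (hx : IsShallowTerminalOf G X x) (f : G.induce X ≃g H) :
    ∃ (e : H ↪g G) (t : W), e t = x ∧ (insert t (H.neighborSet t))ᶜ.Nontrivial ∧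
      InducesPath H (insert t (H.neighborSet t))ᶜ := by
  obtain ⟨-, hterm, hpath⟩ := hx
  have hxX : x ∈ X := hterm.fst
  let e : H ↪g G := (SimpleGraph.Embedding.induce X).comp f.symm.toEmbedding
  have he (w : W) : e w = (f.symm w).1 := rfl
  have hmem (w : W) : e w ∈ X := (f.symm w).2
  have hrange : X ⊆ Set.range e := fun v hv => ⟨f ⟨v, hv⟩, by simp [he]⟩
  obtain ⟨t, rfl⟩ := hrange hxX
  have hnt := hterm.nontrivial
  have hpre : e ⁻¹' (X \ insert (e t) (G.neighborSet (e t))) = (insert t (H.neighborSet t))ᶜ := by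
    ext w
    simp [hmem]
  have hsub : X \ insert (e t) (G.neighborSet (e t)) ⊆ Set.range e :=
    Set.sdiff_subset.trans hrange
  rw [← Set.image_preimage_eq_of_subset hsub, hpre] at hnt
  exact ⟨e, t, rfl, Set.nontrivial_of_image e _ hnt, hpre ▸ hpath.comap e hsub⟩

theorem looseWitness_daggerGraph {d : ℕ} (hd : 2 ≤ d) :
    LooseWitness (daggerGraph d) .s .c .c (fun i => .b ⟨min i (d + 1), by omega⟩) d where
  two_le := hd
  path i j hi hj := by simp [daggerGraph, DaggerRel]; omega
  not_adj _ _ := by simp [daggerGraph, DaggerRel]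
  adj₁ := by simp [daggerGraph, DaggerRel]
  adj₂ := by simp [daggerGraph, DaggerRel]
  mem₁ i hi₁ hi := by simp [daggerGraph, DaggerRel]; omega
  mem₂ i hi₁ hi := by simp [daggerGraph, DaggerRel]; omega
  not_adj₁ := by simp [daggerGraph, DaggerRel]
  not_adj₂ := by simp [daggerGraph, DaggerRel]

theorem looseWitness_ddaggerGraph {d : ℕ} (hd : 2 ≤ d) :
    LooseWitness (ddaggerGraph d) .s .c₁ .c₂ (fun i => .b ⟨min i (d + 1), by omega⟩) d where
  two_le := hd
  path i j hi hj := by simp [ddaggerGraph, DDaggerRel]; omega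
  not_adj _ _ := by simp [ddaggerGraph, DDaggerRel]
  adj₁ := by simp [ddaggerGraph, DDaggerRel]
  adj₂ := by simp [ddaggerGraph, DDaggerRel]
  mem₁ i _ hi := by simp [ddaggerGraph, DDaggerRel]; omega
  mem₂ i hi₁ _ := by simp [ddaggerGraph, DDaggerRel]; omega
  not_adj₁ := by simp [ddaggerGraph, DDaggerRel]
  not_adj₂ := by simp [ddaggerGraph, DDaggerRel]

theorem eq_s_of_inducesPath_daggerGraph {d : ℕ} (hd : 3 ≤ d) {t : DaggerVertex d}
    (hnt : (insert t ((daggerGraph d).neighborSet t))ᶜ.Nontrivial)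
    (hpath : InducesPath (daggerGraph d) (insert t ((daggerGraph d).neighborSet t))ᶜ) :
    t = .s := by
  by_contra hts
  rcases t with _ | _ | i
  · exact hts rfl
  · obtain ⟨v, hv, hadj⟩ := hpath.exists_adj hnt (u := .b ⟨0, by omega⟩)
      (by simp [daggerGraph, DaggerRel])
    cases v <;> simp [daggerGraph, DaggerRel] at hv hadj
    omega
  · obtain hi | hi | ⟨hi, hid⟩ : i.val = 0 ∨ i.val = d + 1 ∨ 1 ≤ i.val ∧ i.val ≤ d := by omega
    · refine hpath.not_triangle (u := .c) (v := .b ⟨2, by omega⟩) (w := .b ⟨3, by omega⟩)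
        ?_ ?_ ?_ ?_ ?_ ?_ <;> simp [daggerGraph, DaggerRel, Fin.ext_iff, hi] <;> omega
    · refine hpath.not_triangle (u := .c) (v := .b ⟨1, by omega⟩) (w := .b ⟨2, by omega⟩)
        ?_ ?_ ?_ ?_ ?_ ?_ <;> simp [daggerGraph, DaggerRel, Fin.ext_iff, hi] <;> omega
    · obtain ⟨v, hv, hadj⟩ := hpath.exists_adj hnt (u := .s) (by simp [daggerGraph, DaggerRel])
      cases v <;> simp [daggerGraph, DaggerRel, hi, hid] at hv hadj

theorem eq_s_of_inducesPath_ddaggerGraph {d : ℕ} (hd : 2 ≤ d) {t : DDaggerVertex d}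
    (hnt : (insert t ((ddaggerGraph d).neighborSet t))ᶜ.Nontrivial)
    (hpath : InducesPath (ddaggerGraph d) (insert t ((ddaggerGraph d).neighborSet t))ᶜ) :
    t = .s := by
  by_contra hts
  rcases t with _ | _ | _ | i
  · exact hts rfl
  · obtain ⟨v, hv, hadj⟩ := hpath.exists_adj hnt (u := .b ⟨d + 1, by omega⟩)
      (by simp [ddaggerGraph, DDaggerRel])
    cases v <;> simp [ddaggerGraph, DDaggerRel] at hv hadj
    omega
  · obtain ⟨v, hv, hadj⟩ := hpath.exists_adj hnt (u := .b ⟨0, by omega⟩)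
      (by simp [ddaggerGraph, DDaggerRel])
    cases v <;> simp [ddaggerGraph, DDaggerRel] at hv hadj
    omega
  · obtain hi | hi | ⟨hi, hid⟩ : i.val = 0 ∨ i.val = d + 1 ∨ 1 ≤ i.val ∧ i.val ≤ d := by omega
    · refine hpath.not_triangle (u := .c₂) (v := .b ⟨2, by omega⟩) (w := .b ⟨3, by omega⟩)
        ?_ ?_ ?_ ?_ ?_ ?_ <;> simp [ddaggerGraph, DDaggerRel, Fin.ext_iff, hi]
    · refine hpath.not_triangle (u := .c₁) (v := .b ⟨0, by omega⟩) (w := .b ⟨1, by omega⟩)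
        ?_ ?_ ?_ ?_ ?_ ?_ <;> simp [ddaggerGraph, DDaggerRel, Fin.ext_iff, hi] <;> omega
    · obtain ⟨v, hv, hadj⟩ := hpath.exists_adj hnt (u := .s) (by simp [ddaggerGraph, DDaggerRel])
      cases v <;> simp [ddaggerGraph, DDaggerRel, hi, hid] at hv hadj

theorem IsShallowTerminalOf.exists_looseWitness {X : Set V} {s : V}
    (hs : IsShallowTerminalOf G X s) : ∃ c₁ c₂ b d, LooseWitness G s c₁ c₂ b d := by
  rcases hs.1 with ⟨d, hd, ⟨f⟩⟩ | ⟨d, hd, ⟨f⟩⟩ <;>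
    obtain ⟨e, t, rfl, hnt, hpath⟩ := hs.exists_embedding f
  · rw [eq_s_of_inducesPath_daggerGraph hd hnt hpath]
    exact ⟨_, _, _, d, (looseWitness_daggerGraph (by omega)).map e⟩
  · rw [eq_s_of_inducesPath_ddaggerGraph hd hnt hpath]
    exact ⟨_, _, _, d, (looseWitness_ddaggerGraph hd).map e⟩

end IntervalDeletion

theorem theorem2p1_general {V : Type*} (G : SimpleGraph V)
    (hG : IntervalDeletion.IsReduced G) (W : Set V) (s : V)
    (hs : IntervalDeletion.IsShallowTerminalOf G W s) :
    IntervalDeletion.IsSimplicial G s := by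
  obtain ⟨c₁, c₂, b, d, h⟩ := hs.exists_looseWitness
  obtain ⟨c₁, c₂, b, d, h⟩ := h.exists_tightWitness hG.1
  exact h.isSimplicial hG

theorem theorem2p1 {V : Type*} [Finite V] (G : SimpleGraph V)
    (hG : IntervalDeletion.IsReduced G) (W : Set V) (s : V)
    (hs : IntervalDeletion.IsShallowTerminalOf G W s) :
    IntervalDeletion.IsSimplicial G s :=
  theorem2p1_general G hG W s hs
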